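/- A pentagon on the sphere $S^2$ is a closed topological disc in $S^2$ whose boundary, a simple closed curve, is divided by five distinct points (its vertices) into five arcs (its edges); the edges may be great arcs, but need not be. An edge-to-edge pentagonal tiling of $S^2$ is a finite family of pentagons that cover $S^2$ and have pairwise disjoint interiors, such that any two distinct tiles meet only in common vertices and along common whole edges, and each edge of a tile is an edge of exactly one other tile. The degree of a vertex is the number of edges of the tiling that end at it, an edge shared by two tiles being counted once. **Proposition.** In every edge-to-edge pentagonal tiling of the sphere $S^2$ in which all vertices have degree at least $3$, there is a tile such that four of its vertices have degree $3$ and its fifth vertex has degree $3$, $4$ or $5$. -/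

import Mathlib

/-- The unit sphere in Euclidean three-space. -/
abbrev UnitSphere : Type := Metric.sphere (0 : EuclideanSpace ℝ (Fin 3)) 1

/-- The point of the unit circle with argument `2 * π * s / 5`; the integers `s = 0, …, 4` give the
five fifth roots of unity in cyclic order. -/
noncomputable def circlePoint (s : ℝ) : ℂ :=
  Complex.exp (((2 * Real.pi * s / 5 : ℝ) : ℂ) * Complex.I)

/-- A topological pentagon on the sphere: a closed disc whose boundary, a simple closed curve, is
divided into five arcs by five distinct points. It is given by an embedding of the closed unit disc
that takes the fifth roots of unity to the five points. (Every closed disc with five marked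
boundary points has such a parametrization. The arcs may be great arcs or any other arcs.) -/
structure SphericalPentagon where
  /-- The parametrization; only its values on the closed unit disc matter. -/
  param : ℂ → UnitSphere
  continuousOn_param : ContinuousOn param (Metric.closedBall 0 1)
  injOn_param : Set.InjOn param (Metric.closedBall 0 1)

namespace SphericalPentagon

/-- The pentagon as a closed subset of the sphere. -/
def region (P : SphericalPentagon) : Set UnitSphere :=
  P.param '' Metric.closedBall 0 1

/-- The pentagon without its boundary curve. -/
def openRegion (P : SphericalPentagon) : Set UnitSphere :=
  P.param '' Metric.ball 0 1

/-- The five vertices, in cyclic order. -/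
noncomputable def vertex (P : SphericalPentagon) (a : Fin 5) : UnitSphere :=
  P.param (circlePoint ((a : ℕ) : ℝ))

/-- The five edges, in cyclic order; the edge `a` is the closed boundary arc from the vertex `a`
to the vertex `a + 1` (indices modulo 5). -/
def edge (P : SphericalPentagon) (a : Fin 5) : Set UnitSphere :=
  (fun s : ℝ => P.param (circlePoint s)) '' Set.Icc ((a : ℕ) : ℝ) (((a : ℕ) : ℝ) + 1)

end SphericalPentagon

/-- An edge-to-edge tiling of the sphere by the pentagons `T i`. -/
structure IsEdgeToEdgeTiling {ι : Type*} (T : ι → SphericalPentagon) : Prop where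
  /-- The tiles cover the sphere. -/
  cover : ⋃ i, (T i).region = Set.univ
  /-- Distinct tiles have disjoint interiors. -/
  disjoint_openRegion : ∀ i j, i ≠ j → Disjoint (T i).openRegion (T j).openRegion
  /-- Distinct tiles meet only in common vertices and along common whole edges. -/
  meet : ∀ i j, i ≠ j → ∀ x ∈ (T i).region ∩ (T j).region,
    (∃ a b, (T i).vertex a = x ∧ (T j).vertex b = x) ∨
      (∃ a b, (T i).edge a = (T j).edge b ∧ x ∈ (T i).edge a)
  /-- Each edge of a tile is an edge of exactly one other tile. -/
  edge_shared : ∀ i a, ∃! j, j ≠ i ∧ ∃ b, (T j).edge b = (T i).edge a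

/-- The degree of a point `x` in a family of pentagons: the number of edges (as subsets of the
sphere, so that an edge shared by two tiles counts once) of which `x` is an end point. -/
noncomputable def vertexDegree {ι : Type*} (T : ι → SphericalPentagon) (x : UnitSphere) : ℕ :=
  Set.ncard {e : Set UnitSphere |
    ∃ i a, (T i).edge a = e ∧ ((T i).vertex a = x ∨ (T i).vertex (a + 1) = x)}

/-!
Give each corner of a tile at a vertex of degree `d` the weight `1 / d`. At every vertex there are
at least as many corners as edges, so the sum of all weights is at least the number `V` of
vertices. If a tile is not of the required kind, then either two of its vertices have degree at
least `4`, or four have degree `3` and the fifth has degree at least `6`; in both cases its five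
weights add up to at most `3 / 2` (`sum_inv_le_of_forall_not`). Were there no tile of the required
kind, `V` would be at most `3 F / 2`, where `F` is the number of tiles. As each edge belongs to at
most two tiles, the number `E` of edges is at least `5 F / 2`, so `V - E + F ≤ 0`. This
contradicts the topology of the sphere, in the form of the inequality `V - E + F ≥ 1`
(`IsEdgeToEdgeTiling.card_edgeFinset_lt`).

The inequality is linear algebra over `ZMod 2`, once it is known that every function on the edges
whose sum over the boundary of each tile vanishes is the coboundary of a function on the vertices
(`IsEdgeToEdgeTiling.exists_coboundary`). Such a cocycle has a primitive on the vertices of each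
tile, unique up to a constant, and on the intersection of two tiles the primitives differ by a
constant near each point. Hence the primitives describe a double covering of the sphere. Over the
complement of a point, which is simply connected, the covering has a section; two such sections
can be glued because the sphere without two points is connected
(`IsLocalDifference.exists_isPotentialOn_unitSphere`). The global section corrects the primitives
to one function on all vertices. Neither the Jordan curve theorem nor any knowledge of how the
tiles are arranged around a vertex is needed.
-/

open Set Filter Topology

/-! ### Torsors over the sphere -/

/-- A family of differences `g p q`, meaningful for `q` close to `p`, with the local cocycle
property. It describes a `G`-torsor over `X` (a covering of `X` with group `G`) trivialized near
each point. -/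
def IsLocalDifference {X G : Type*} [TopologicalSpace X] [AddCommGroup G] (g : X → X → G) : Prop :=
  ∀ p, ∀ᶠ x in 𝓝 p, ∀ᶠ y in 𝓝 x, g p y = g p x + g x y

/-- The function `σ` has the prescribed differences near each point of `U`; equivalently, `σ` is a
section over `U` of the torsor described by `g`. -/
def IsPotentialOn {X G : Type*} [TopologicalSpace X] [AddCommGroup G] (g : X → X → G)
    (σ : X → G) (U : Set X) : Prop :=
  ∀ p ∈ U, ∀ᶠ q in 𝓝 p, σ q = σ p + g p q

section Potential

variable {X Y G : Type*} [TopologicalSpace X] [TopologicalSpace Y] [AddCommGroup G]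
  {g : X → X → G}

theorem IsLocalDifference.comp (hg : IsLocalDifference g) {φ : Y → X} (hφ : Continuous φ) :
    IsLocalDifference fun p q => g (φ p) (φ q) := by
  intro p
  filter_upwards [hφ.continuousAt.eventually (hg (φ p))] with x hx
  exact hφ.continuousAt.eventually hx

/-- The covering of `X` with fibre `G` described by the local differences `g`. In the chart around
`p`, the value `v` over `x` has the coordinate `v - g p x`. -/
def IsLocalDifference.core [TopologicalSpace G] [DiscreteTopology G]
    (hg : IsLocalDifference g) : FiberBundleCore X X G where
  baseSet p := interior {x | ∀ᶠ y in 𝓝 x, g p y = g p x + g x y}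
  isOpen_baseSet _ := isOpen_interior
  indexAt x := x
  mem_baseSet_at x := mem_interior_iff_mem_nhds.2 (hg x)
  coordChange p q x v := v + g p x - g q x
  coordChange_self _ _ _ _ := by simp
  continuousOn_coordChange p q := by
    rintro ⟨x, v⟩ ⟨⟨hp, hq⟩, -⟩
    apply ContinuousAt.continuousWithinAt
    have hp := interior_subset hp
    have hq := interior_subset hq
    have hx : ∀ᶠ z : X × G in 𝓝 (x, v), g p z.1 = g p x + g x z.1 ∧ g q z.1 = g q x + g x z.1 :=
      continuousAt_fst.eventually (hp.and hq)
    refine (show ContinuousAt (fun z : X × G => z.2 + (g p x - g q x)) (x, v) from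
      ContinuousAt.add continuousAt_snd continuousAt_const).congr ?_
    filter_upwards [hx] with z hz
    rw [hz.1, hz.2]
    abel
  coordChange_comp _ _ _ _ _ _ := by abel

/-- Over a simply connected space, the covering described by `g` has a global section. -/
theorem IsLocalDifference.exists_isPotentialOn_univ [SimplyConnectedSpace X]
    [LocallyPathConnectedSpace X] (hg : IsLocalDifference g) :
    ∃ σ, IsPotentialOn g σ univ := by
  let _ : TopologicalSpace G := ⊥
  have : DiscreteTopology G := ⟨rfl⟩
  have hcov : IsCoveringMap (Bundle.TotalSpace.proj : hg.core.TotalSpace → X) :=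
    FiberBundle.isCoveringMap
  obtain ⟨x₀⟩ : Nonempty X := inferInstance
  obtain ⟨s, ⟨-, hs⟩, -⟩ := hcov.existsUnique_continuousMap_lifts (ContinuousMap.id X) x₀
    (⟨x₀, (0 : G)⟩ : hg.core.TotalSpace) rfl
  have hs1 : ∀ x, (s x).1 = x := fun x => congrFun hs x
  refine ⟨fun x => (s x).2, fun p _ => ?_⟩
  -- In the chart around `p` the section is a continuous function with values in a discrete group.
  have hpp : p ∈ (hg.core.localTriv p).baseSet := hg.core.mem_baseSet_at p
  have hc : ContinuousAt (fun x => (hg.core.localTriv p (s x)).2) p := by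
    refine continuousAt_snd.comp (ContinuousAt.comp ?_ s.continuous.continuousAt)
    apply (hg.core.localTriv p).continuousAt
    rw [hg.core.mem_localTriv_source, hs1]
    exact hpp
  have hval : ∀ x, (hg.core.localTriv p (s x)).2 = (show G from (s x).2) + g x x - g p x := by
    intro x
    rw [hg.core.localTriv_apply]
    change (show G from (s x).2) + g (s x).1 (s x).1 - g p (s x).1 = _
    rw [hs1]
  have hzero : ∀ x, g x x = 0 := fun x => by
    have h := (hg x).self_of_nhds.self_of_nhds
    simpa using h
  have hev := hc.eventually (isOpen_discrete {(hg.core.localTriv p (s p)).2} |>.mem_nhds rfl)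
  filter_upwards [hev] with q hq
  have hq : (hg.core.localTriv p (s q)).2 = (hg.core.localTriv p (s p)).2 := hq
  rw [hval, hval, hzero, hzero, sub_zero] at hq
  have hq := sub_eq_iff_eq_add.1 hq
  rwa [add_zero, add_zero] at hq

/-- On the preconnected set `U ∩ V` two potentials differ by a constant, so that they can be glued
after a translation of one of them. -/
theorem IsPotentialOn.exists_union {U V : Set X} {σ τ : X → G} (hU : IsOpen U) (hV : IsOpen V)
    (hUV : IsPreconnected (U ∩ V)) (hσ : IsPotentialOn g σ U) (hτ : IsPotentialOn g τ V) :
    ∃ ρ, IsPotentialOn g ρ (U ∪ V) := by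
  classical
  let _ : TopologicalSpace G := ⊥
  have : DiscreteTopology G := ⟨rfl⟩
  obtain ⟨d, hd⟩ : ∃ d, ∀ x ∈ U ∩ V, σ x = τ x + d := by
    have hcont : ContinuousOn (fun x => σ x - τ x) (U ∩ V) := by
      intro x hx
      refine ContinuousAt.continuousWithinAt
        ((continuousAt_const (y := σ x - τ x)).congr ?_)
      filter_upwards [hσ x hx.1, hτ x hx.2] with y h1 h2
      rw [h1, h2]
      abel
    rcases (U ∩ V).eq_empty_or_nonempty with h | ⟨y, hy⟩
    · exact ⟨0, by simp [h]⟩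
    · refine ⟨σ y - τ y, fun x hx => ?_⟩
      rw [← hUV.constant hcont hx hy]
      abel
  have hρV : ∀ x ∈ V, (if x ∈ U then σ x else τ x + d) = τ x + d := by
    intro x hx
    split_ifs with h
    · exact hd x ⟨h, hx⟩
    · rfl
  refine ⟨fun x => if x ∈ U then σ x else τ x + d, ?_⟩
  rintro p (hp | hp)
  · filter_upwards [hσ p hp, hU.mem_nhds hp] with q h1 h2
    rw [if_pos h2, if_pos hp, h1]
  · filter_upwards [hτ p hp, hV.mem_nhds hp] with q h1 h2
    rw [hρV q h2, hρV p hp, h1]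
    abel

/-- Away from one point, the sphere is a plane, hence simply connected. -/
theorem IsLocalDifference.exists_isPotentialOn_compl_singleton {g : UnitSphere → UnitSphere → G}
    (hg : IsLocalDifference g) (v : UnitSphere) : ∃ σ, IsPotentialOn g σ {v}ᶜ := by
  have hv : ‖(v : EuclideanSpace ℝ (Fin 3))‖ = 1 := by simp
  set S := stereographic hv with hS
  have hcont : Continuous S.symm := by
    rw [← continuousOn_univ, ← stereographic_target hv]
    exact S.continuousOn_symm
  obtain ⟨τ, hτ⟩ := (hg.comp hcont).exists_isPotentialOn_univ
  have hsrc : S.source = {v}ᶜ := stereographic_source hv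
  refine ⟨fun x => τ (S x), fun p hp => ?_⟩
  have hp' : p ∈ S.source := by rwa [hsrc]
  filter_upwards [(S.continuousAt hp').eventually (hτ (S p) (mem_univ _)),
    S.open_source.mem_nhds hp'] with q h1 h2
  rw [h1, S.left_inv hp', S.left_inv h2]

/-- The sphere without two antipodal points is a plane without a point. -/
theorem isPreconnected_compl_singleton_inter (v : UnitSphere) :
    IsPreconnected (({v}ᶜ : Set UnitSphere) ∩ {-v}ᶜ) := by
  have hv : ‖(v : EuclideanSpace ℝ (Fin 3))‖ = 1 := by simp
  have hv0 : (v : EuclideanSpace ℝ (Fin 3)) ≠ 0 := by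
    rintro h
    simp [h] at hv
  set S := stereographic hv with hS
  have hcont : Continuous S.symm := by
    rw [← continuousOn_univ, ← stereographic_target hv]
    exact S.continuousOn_symm
  have hsrc : S.source = {v}ᶜ := stereographic_source hv
  have htgt : S.target = univ := stereographic_target hv
  have : Fact (Module.finrank ℝ (EuclideanSpace ℝ (Fin 3)) = 2 + 1) := ⟨by simp⟩
  have hrank : 1 < Module.rank ℝ (Submodule.span ℝ {(v : EuclideanSpace ℝ (Fin 3))})ᗮ := by
    rw [← Module.finrank_eq_rank, Submodule.finrank_orthogonal_span_singleton (n := 2) hv0]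
    norm_num
  have himg : ({v}ᶜ : Set UnitSphere) ∩ {-v}ᶜ = S.symm '' {S (-v)}ᶜ := by
    have hne : -v ∈ S.source := by
      rw [hsrc, mem_compl_singleton_iff]
      exact (ne_neg_of_mem_unit_sphere ℝ v).symm
    ext x
    constructor
    · rintro ⟨h1, h2⟩
      have hx : x ∈ S.source := by rwa [hsrc]
      exact ⟨S x, fun h => h2 (S.injOn hx hne h), S.left_inv hx⟩
    · rintro ⟨y, hy, rfl⟩
      have hy' : y ∈ S.target := by simp [htgt]
      refine ⟨?_, fun h => hy ?_⟩
      · rw [← hsrc]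
        exact S.map_target hy'
      · rw [mem_singleton_iff] at h ⊢
        rw [← h, S.right_inv hy']
  rw [himg]
  exact ((isPathConnected_compl_singleton_of_one_lt_rank hrank _).isConnected.isPreconnected).image
    _ hcont.continuousOn

/-- The first cohomology of the sphere vanishes: every torsor over it has a global section. -/
theorem IsLocalDifference.exists_isPotentialOn_unitSphere {g : UnitSphere → UnitSphere → G}
    (hg : IsLocalDifference g) : ∃ σ, IsPotentialOn g σ univ := by
  obtain ⟨v⟩ : Nonempty UnitSphere := (NormedSpace.sphere_nonempty.2 zero_le_one).to_subtype
  obtain ⟨σ, hσ⟩ := hg.exists_isPotentialOn_compl_singleton v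
  obtain ⟨τ, hτ⟩ := hg.exists_isPotentialOn_compl_singleton (-v)
  obtain ⟨ρ, hρ⟩ := hσ.exists_union isOpen_compl_singleton isOpen_compl_singleton
    (isPreconnected_compl_singleton_inter v) hτ
  refine ⟨ρ, fun p _ => hρ p ?_⟩
  by_contra h
  simp only [mem_union, mem_compl_iff, mem_singleton_iff, not_or, not_not] at h
  exact ne_neg_of_mem_unit_sphere ℝ v (h.1.symm.trans h.2)

end Potential

/-! ### Arcs and the boundary of a pentagon -/

section Arcs

variable {X : Type*} [TopologicalSpace X] [T2Space X]

theorem endpoints_mem_of_image_Icc_eq {f g : ℝ → X} {a b c d : ℝ} (hab : a ≤ b) (hcd : c ≤ d)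
    (hf : ContinuousOn f (Icc a b)) (hg : ContinuousOn g (Icc c d)) (hfi : InjOn f (Icc a b))
    (hgi : InjOn g (Icc c d)) (h : f '' Icc a b = g '' Icc c d) :
    (f a = g c ∨ f a = g d) ∧ (f b = g c ∨ f b = g d) := by
  have hex : ∀ s : Icc a b, ∃ t : Icc c d, g t = f s := fun s => by
    obtain ⟨t, ht, hts⟩ := h ▸ mem_image_of_mem f s.2
    exact ⟨⟨t, ht⟩, hts⟩
  choose φ hφ using hex
  have hemb : IsClosedEmbedding ((Icc c d).domRestrict g) :=
    hg.domRestrict.isClosedEmbedding hgi.injective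
  have hφc : Continuous φ := by
    rw [hemb.isInducing.continuous_iff]
    exact hf.domRestrict.congr fun s => (hφ s).symm
  -- The change of parameter `g⁻¹ ∘ f` is continuous and injective, hence strictly monotone or
  -- strictly antitone.
  set ψ : ℝ → ℝ := fun s => φ (projIcc a b hab s) with hψ
  have hψc : ContinuousOn ψ (Icc a b) :=
    (continuous_subtype_val.comp (hφc.comp continuous_projIcc)).continuousOn
  have hgψ : ∀ s ∈ Icc a b, g (ψ s) = f s := fun s hs => by
    simp only [hψ, hφ, projIcc_of_mem hab hs]
  have hψm : ∀ s, ψ s ∈ Icc c d := fun s => (φ _).2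
  have hψi : InjOn ψ (Icc a b) := fun s hs t ht hst => hfi hs ht <| by
    rw [← hgψ s hs, ← hgψ t ht, hst]
  have hsurj : ∀ t ∈ Icc c d, ∃ s ∈ Icc a b, ψ s = t := fun t ht => by
    obtain ⟨s, hs, hst⟩ := h.symm ▸ mem_image_of_mem g ht
    exact ⟨s, hs, hgi (hψm s) ht ((hgψ s hs).trans hst)⟩
  have ha := left_mem_Icc.2 hab
  have hb := right_mem_Icc.2 hab
  obtain ⟨s, hs, hsc⟩ := hsurj c (left_mem_Icc.2 hcd)
  obtain ⟨t, ht, htd⟩ := hsurj d (right_mem_Icc.2 hcd)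
  rw [← hgψ a ha, ← hgψ b hb]
  rcases hψc.strictMonoOn_of_injOn_Icc' hab hψi with hm | hm
  · have h1 := hm.monotoneOn ha hs hs.1
    have h2 := hm.monotoneOn ht hb ht.2
    have h3 : ψ a = c := le_antisymm (h1.trans_eq hsc) (hψm a).1
    have h4 : ψ b = d := le_antisymm (hψm b).2 (htd.symm.trans_le h2)
    exact ⟨Or.inl (by rw [h3]), Or.inr (by rw [h4])⟩
  · have h1 := hm.antitoneOn ha ht ht.1
    have h2 := hm.antitoneOn hs hb hs.2
    have h3 : ψ a = d := le_antisymm (hψm a).2 (htd.symm.trans_le h1)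
    have h4 : ψ b = c := le_antisymm (h2.trans_eq hsc) (hψm b).1
    exact ⟨Or.inr (by rw [h3]), Or.inl (by rw [h4])⟩

/-- The end points of an arc do not depend on its parametrization. -/
theorem pair_eq_of_image_Icc_eq {f g : ℝ → X} {a b c d : ℝ} (hab : a ≤ b) (hcd : c ≤ d)
    (hf : ContinuousOn f (Icc a b)) (hg : ContinuousOn g (Icc c d)) (hfi : InjOn f (Icc a b))
    (hgi : InjOn g (Icc c d)) (h : f '' Icc a b = g '' Icc c d) :
    ({f a, f b} : Set X) = {g c, g d} := by
  have h1 := endpoints_mem_of_image_Icc_eq hab hcd hf hg hfi hgi h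
  have h2 := endpoints_mem_of_image_Icc_eq hcd hab hg hf hgi hfi h.symm
  apply Subset.antisymm
  · rintro x (rfl | rfl)
    exacts [h1.1, h1.2]
  · rintro x (rfl | rfl)
    exacts [h2.1, h2.2]

end Arcs

theorem continuous_circlePoint : Continuous circlePoint := by
  unfold circlePoint
  fun_prop

theorem norm_circlePoint (s : ℝ) : ‖circlePoint s‖ = 1 :=
  Complex.norm_exp_ofReal_mul_I _

theorem circlePoint_mem_closedBall (s : ℝ) : circlePoint s ∈ Metric.closedBall (0 : ℂ) 1 := by
  simp [norm_circlePoint]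

theorem circlePoint_eq_iff {s t : ℝ} : circlePoint s = circlePoint t ↔ ∃ n : ℤ, s = t + 5 * n := by
  unfold circlePoint
  rw [Complex.exp_eq_exp_iff_exists_int]
  refine exists_congr fun n => ?_
  have hpi := Real.pi_ne_zero
  constructor
  · intro h
    have h2 : ((2 * Real.pi * s / 5 : ℝ) : ℂ) =
        ((2 * Real.pi * t / 5 + n * (2 * Real.pi) : ℝ) : ℂ) := by
      apply mul_right_cancel₀ Complex.I_ne_zero
      rw [h]
      push_cast
      ring
    have h3 := Complex.ofReal_injective h2
    field_simp at h3
    linarith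
  · rintro rfl
    push_cast
    ring

namespace SphericalPentagon

variable (P : SphericalPentagon)

/-- The boundary curve, of period `5`; the vertices are its values at the integers. -/
noncomputable def boundary (s : ℝ) : UnitSphere :=
  P.param (circlePoint s)

theorem continuous_boundary : Continuous P.boundary :=
  P.continuousOn_param.comp_continuous continuous_circlePoint circlePoint_mem_closedBall

variable {P} in
theorem boundary_eq_iff {s t : ℝ} : P.boundary s = P.boundary t ↔ ∃ n : ℤ, s = t + 5 * n := by
  rw [← circlePoint_eq_iff]
  exact P.injOn_param.eq_iff (circlePoint_mem_closedBall s) (circlePoint_mem_closedBall t)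

theorem vertex_eq_boundary (a : Fin 5) : P.vertex a = P.boundary ((a : ℕ) : ℝ) := rfl

theorem vertex_add_one_eq_boundary (a : Fin 5) :
    P.vertex (a + 1) = P.boundary (((a : ℕ) : ℝ) + 1) := by
  rw [vertex_eq_boundary, boundary_eq_iff]
  by_cases h : a = 4
  · exact ⟨-1, by subst h; norm_num⟩
  · refine ⟨0, ?_⟩
    have : ((a + 1 : Fin 5) : ℕ) = a + 1 := by omega
    simp [this]

theorem vertex_injective : Function.Injective P.vertex := by
  intro a b h
  rw [vertex_eq_boundary, vertex_eq_boundary, boundary_eq_iff] at h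
  obtain ⟨n, hn⟩ := h
  have hn : ((a : ℕ) : ℤ) = (b : ℕ) + 5 * n := by exact_mod_cast hn
  omega

theorem vertex_mem_edge (a : Fin 5) : P.vertex a ∈ P.edge a :=
  ⟨_, left_mem_Icc.2 (by linarith), rfl⟩

theorem vertex_add_one_mem_edge (a : Fin 5) : P.vertex (a + 1) ∈ P.edge a := by
  rw [vertex_add_one_eq_boundary]
  exact ⟨_, right_mem_Icc.2 (by linarith), rfl⟩

theorem edge_subset_region (a : Fin 5) : P.edge a ⊆ P.region := by
  rintro x ⟨s, -, rfl⟩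
  exact mem_image_of_mem _ (circlePoint_mem_closedBall s)

theorem vertex_mem_region (a : Fin 5) : P.vertex a ∈ P.region :=
  P.edge_subset_region a (P.vertex_mem_edge a)

theorem isClosed_region : IsClosed P.region :=
  ((isCompact_closedBall _ _).image_of_continuousOn P.continuousOn_param).isClosed

theorem isPreconnected_region : IsPreconnected P.region :=
  (convex_closedBall _ _).isPreconnected.image _ P.continuousOn_param

theorem isClosed_edge (a : Fin 5) : IsClosed (P.edge a) :=
  (isCompact_Icc.image P.continuous_boundary).isClosed

variable {P}

/-- An inner point of an edge lies on no other edge. -/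
theorem eq_of_boundary_mem_edge {a b : Fin 5} {s : ℝ}
    (hs : s ∈ Ioo ((a : ℕ) : ℝ) (((a : ℕ) : ℝ) + 1)) (h : P.boundary s ∈ P.edge b) : a = b := by
  obtain ⟨t, ht, hts⟩ := h
  obtain ⟨n, rfl⟩ := boundary_eq_iff.1 hts
  have h1 : ((b : ℕ) : ℝ) < (((a : ℕ) : ℝ) + 1) + 5 * n := by linarith [ht.1, hs.2]
  have h2 : ((a : ℕ) : ℝ) + 5 * n < ((b : ℕ) : ℝ) + 1 := by linarith [ht.2, hs.1]
  have h1 : ((b : ℕ) : ℤ) < (((a : ℕ) : ℤ) + 1) + 5 * n := by exact_mod_cast h1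
  have h2 : ((a : ℕ) : ℤ) + 5 * n < ((b : ℕ) : ℤ) + 1 := by exact_mod_cast h2
  omega

theorem edge_injective : Function.Injective P.edge := by
  intro a b h
  have hs : ((a : ℕ) : ℝ) + 1 / 2 ∈ Ioo ((a : ℕ) : ℝ) (((a : ℕ) : ℝ) + 1) := by
    constructor <;> linarith
  have hm : P.boundary (((a : ℕ) : ℝ) + 1 / 2) ∈ P.edge a :=
    mem_image_of_mem P.boundary (Ioo_subset_Icc_self hs)
  exact eq_of_boundary_mem_edge hs (h ▸ hm)

theorem eq_vertex_or_exists_of_mem_edge {a : Fin 5} {x : UnitSphere} (h : x ∈ P.edge a) :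
    x = P.vertex a ∨ x = P.vertex (a + 1) ∨
      ∃ s ∈ Ioo ((a : ℕ) : ℝ) (((a : ℕ) : ℝ) + 1), P.boundary s = x := by
  obtain ⟨s, hs, rfl⟩ := h
  rcases hs.1.eq_or_lt with h1 | h1
  · left
    rw [← h1]
    rfl
  rcases hs.2.eq_or_lt with h2 | h2
  · right; left
    rw [vertex_add_one_eq_boundary, ← h2]
    rfl
  · exact Or.inr (Or.inr ⟨s, ⟨h1, h2⟩, rfl⟩)

theorem eq_of_mem_edge_of_mem_edge {a b : Fin 5} {x : UnitSphere} (hx : ∀ c, P.vertex c ≠ x)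
    (ha : x ∈ P.edge a) (hb : x ∈ P.edge b) : a = b := by
  rcases eq_vertex_or_exists_of_mem_edge ha with h | h | ⟨s, hs, rfl⟩
  · exact absurd h.symm (hx _)
  · exact absurd h.symm (hx _)
  · exact eq_of_boundary_mem_edge hs hb

theorem vertex_mem_edge_iff {a b : Fin 5} : P.vertex b ∈ P.edge a ↔ b = a ∨ b = a + 1 := by
  constructor
  · intro h
    rcases eq_vertex_or_exists_of_mem_edge h with h | h | ⟨s, hs, h⟩
    · exact Or.inl (P.vertex_injective h)
    · exact Or.inr (P.vertex_injective h)
    · exact Or.inl (eq_of_boundary_mem_edge hs (h ▸ P.vertex_mem_edge b)).symm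
  · rintro (rfl | rfl)
    · exact P.vertex_mem_edge b
    · exact P.vertex_add_one_mem_edge a

theorem injOn_boundary (a : Fin 5) :
    InjOn P.boundary (Icc ((a : ℕ) : ℝ) (((a : ℕ) : ℝ) + 1)) := by
  intro s hs t ht h
  obtain ⟨n, rfl⟩ := boundary_eq_iff.1 h
  have h1 : (5 * n : ℝ) ≤ 1 := by linarith [hs.2, ht.1]
  have h2 : (-1 : ℝ) ≤ 5 * n := by linarith [hs.1, ht.2]
  have h1 : 5 * n ≤ 1 := by exact_mod_cast h1
  have h2 : -1 ≤ 5 * n := by exact_mod_cast h2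
  obtain rfl : n = 0 := by omega
  simp

theorem pair_vertex_eq_of_edge_eq {Q : SphericalPentagon} {a b : Fin 5} (h : P.edge a = Q.edge b) :
    ({P.vertex a, P.vertex (a + 1)} : Set UnitSphere) = {Q.vertex b, Q.vertex (b + 1)} := by
  rw [vertex_add_one_eq_boundary, vertex_add_one_eq_boundary]
  exact pair_eq_of_image_Icc_eq (by linarith) (by linarith) P.continuous_boundary.continuousOn
    Q.continuous_boundary.continuousOn (injOn_boundary a) (injOn_boundary b) h

end SphericalPentagon

/-! ### Incidences in a tiling -/

section Tiling

variable {ι : Type*} {T : ι → SphericalPentagon}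

namespace IsEdgeToEdgeTiling

theorem exists_mem_region (hT : IsEdgeToEdgeTiling T) (x : UnitSphere) : ∃ i, x ∈ (T i).region :=
  mem_iUnion.1 (hT.cover ▸ mem_univ x)

/-- A vertex of the tiling that lies on a tile is a vertex of this tile. -/
theorem exists_vertex_eq (hT : IsEdgeToEdgeTiling T) {i j : ι} {a : Fin 5}
    (h : (T i).vertex a ∈ (T j).region) : ∃ b, (T j).vertex b = (T i).vertex a := by
  by_cases hij : i = j
  · subst hij
    exact ⟨a, rfl⟩
  rcases hT.meet i j hij _ ⟨(T i).vertex_mem_region a, h⟩ with ⟨-, b, -, hb⟩ | ⟨c, b, he, hx⟩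
  · exact ⟨b, hb⟩
  · have hmem : (T i).vertex a ∈ ({(T i).vertex c, (T i).vertex (c + 1)} : Set UnitSphere) := by
      rcases SphericalPentagon.vertex_mem_edge_iff.1 hx with rfl | rfl
      exacts [Or.inl rfl, Or.inr rfl]
    rw [SphericalPentagon.pair_vertex_eq_of_edge_eq he] at hmem
    rcases hmem with h | h
    exacts [⟨_, h.symm⟩, ⟨_, h.symm⟩]

/-- A tile that contains an inner point of an edge has this edge. -/
theorem exists_edge_eq (hT : IsEdgeToEdgeTiling T) {i j : ι} {a : Fin 5} {x : UnitSphere}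
    (hx : ∀ k c, (T k).vertex c ≠ x) (hi : x ∈ (T i).edge a) (hj : x ∈ (T j).region) :
    ∃ b, (T j).edge b = (T i).edge a := by
  by_cases hij : i = j
  · subst hij
    exact ⟨a, rfl⟩
  rcases hT.meet i j hij x ⟨(T i).edge_subset_region a hi, hj⟩ with ⟨c, -, h, -⟩ | ⟨c, b, he, hxc⟩
  · exact absurd h (hx _ _)
  · obtain rfl := SphericalPentagon.eq_of_mem_edge_of_mem_edge (hx i) hi hxc
    exact ⟨b, he.symm⟩

theorem edge_eq_of_mem_of_mem (hT : IsEdgeToEdgeTiling T) {i j : ι} {a b : Fin 5} {x : UnitSphere}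
    (hx : ∀ k c, (T k).vertex c ≠ x) (hi : x ∈ (T i).edge a) (hj : x ∈ (T j).edge b) :
    (T i).edge a = (T j).edge b := by
  obtain ⟨c, hc⟩ := hT.exists_edge_eq hx hi ((T j).edge_subset_region b hj)
  obtain rfl := SphericalPentagon.eq_of_mem_edge_of_mem_edge (hx j) hj (hc ▸ hi)
  exact hc.symm

end IsEdgeToEdgeTiling

/-! ### Cocycles of a tiling -/

/-- The relation that every tile, edge and vertex containing `q` contains `p`; it holds for all `q`
close to `p`. -/
def IsNear (T : ι → SphericalPentagon) (p q : UnitSphere) : Prop :=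
  (∀ i, q ∈ (T i).region → p ∈ (T i).region) ∧ (∀ i a, q ∈ (T i).edge a → p ∈ (T i).edge a) ∧
    ∀ i a, (T i).vertex a = q → (T i).vertex a = p

theorem eventually_isNear [Finite ι] (T : ι → SphericalPentagon) (p : UnitSphere) :
    ∀ᶠ q in 𝓝 p, IsNear T p q := by
  have key : ∀ s : Set UnitSphere, IsClosed s → ∀ᶠ q in 𝓝 p, q ∈ s → p ∈ s := by
    intro s hs
    by_cases hp : p ∈ s
    · exact Eventually.of_forall fun _ _ => hp
    · filter_upwards [hs.isOpen_compl.mem_nhds hp] with q hq h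
      exact absurd h hq
  refine Eventually.and (eventually_all.2 fun i => key _ (T i).isClosed_region) (Eventually.and
    (eventually_all.2 fun i => eventually_all.2 fun a => key _ ((T i).isClosed_edge a))
    (eventually_all.2 fun i => eventually_all.2 fun a => ?_))
  filter_upwards [key {(T i).vertex a} isClosed_singleton] with q hq h
  exact (hq h.symm).symm

open Classical in
/-- A vertex attached to each point `p` of the 1-skeleton: `p` itself if it is a vertex, and
otherwise a chosen end point of the edge through `p`. Outside the 1-skeleton the value is
immaterial. -/
noncomputable def nearbyVertex (T : ι → SphericalPentagon) (p : UnitSphere) : UnitSphere :=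
  if ∃ i a, (T i).vertex a = p then p
  else if h : ∃ x : ι × Fin 5, p ∈ (T x.1).edge x.2 then (T h.choose.1).vertex h.choose.2
  else p

theorem nearbyVertex_vertex (T : ι → SphericalPentagon) (i : ι) (a : Fin 5) :
    nearbyVertex T ((T i).vertex a) = (T i).vertex a :=
  if_pos ⟨i, a, rfl⟩

theorem IsEdgeToEdgeTiling.nearbyVertex_mem (hT : IsEdgeToEdgeTiling T) {i : ι} {a : Fin 5}
    {p : UnitSphere} (hp : p ∈ (T i).edge a) :
    nearbyVertex T p ∈ ({(T i).vertex a, (T i).vertex (a + 1)} : Set UnitSphere) := by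
  by_cases hv : ∃ j b, (T j).vertex b = p
  · obtain ⟨j, b, rfl⟩ := hv
    rw [nearbyVertex_vertex]
    obtain ⟨c, hc⟩ := hT.exists_vertex_eq ((T i).edge_subset_region a hp)
    rw [← hc] at hp ⊢
    rcases SphericalPentagon.vertex_mem_edge_iff.1 hp with rfl | rfl
    exacts [Or.inl rfl, Or.inr rfl]
  · have h : ∃ x : ι × Fin 5, p ∈ (T x.1).edge x.2 := ⟨(i, a), hp⟩
    rw [nearbyVertex, if_neg hv, dif_pos h, SphericalPentagon.pair_vertex_eq_of_edge_eq
      (hT.edge_eq_of_mem_of_mem (fun k c hk => hv ⟨k, c, hk⟩) hp h.choose_spec)]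
    exact Or.inl rfl

theorem exists_primitive_fin_five {G : Type*} [AddCommGroup G] (c : Fin 5 → G)
    (hc : ∑ a, c a = 0) : ∃ F : Fin 5 → G, ∀ a, F (a + 1) = F a + c a := by
  refine ⟨![0, c 0, c 0 + c 1, c 0 + c 1 + c 2, c 0 + c 1 + c 2 + c 3], fun a => ?_⟩
  rw [Fin.sum_univ_five] at hc
  fin_cases a
  · exact (zero_add _).symm
  · rfl
  · rfl
  · rfl
  · exact hc.symm

theorem SphericalPentagon.exists_primitive (P : SphericalPentagon) {G : Type*} [AddCommGroup G]
    (c : Fin 5 → G) (hc : ∑ a, c a = 0) :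
    ∃ f : UnitSphere → G, ∀ a, f (P.vertex (a + 1)) = f (P.vertex a) + c a := by
  obtain ⟨F, hF⟩ := exists_primitive_fin_five c hc
  refine ⟨Function.extend P.vertex F 0, fun a => ?_⟩
  rw [P.vertex_injective.extend_apply, P.vertex_injective.extend_apply, hF]

/-- With coefficients modulo `2`, the difference of the values of a primitive at two end points of
an edge depends only on the two points and the edge. -/
theorem sub_eq_ite_of_mem_pair {f : UnitSphere → ZMod 2} {c : ZMod 2} {u v x y : UnitSphere}
    [Decidable (x = y)] (huv : f v = f u + c) (hne : u ≠ v) (hx : x ∈ ({u, v} : Set UnitSphere))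
    (hy : y ∈ ({u, v} : Set UnitSphere)) : f x - f y = if x = y then 0 else c := by
  rcases hx with rfl | rfl <;> rcases hy with rfl | rfl
  · simp
  · rw [if_neg hne, huv, sub_add_cancel_left, ZMod.neg_eq_self_mod_two]
  · rw [if_neg hne.symm, huv, add_sub_cancel_left]
  · simp

/-- Primitives of a cocycle on two tiles differ by the same constant at nearby points of the
intersection of the tiles. -/
theorem IsEdgeToEdgeTiling.primitive_sub_eq (hT : IsEdgeToEdgeTiling T)
    {C : Set UnitSphere → ZMod 2} {f : ι → UnitSphere → ZMod 2}
    (hf : ∀ i a, f i ((T i).vertex (a + 1)) = f i ((T i).vertex a) + C ((T i).edge a))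
    {p q : UnitSphere} (hpq : IsNear T p q) {i j : ι} (hi : q ∈ (T i).region)
    (hj : q ∈ (T j).region) :
    f i (nearbyVertex T q) - f i (nearbyVertex T p) =
      f j (nearbyVertex T q) - f j (nearbyVertex T p) := by
  classical
  by_cases hij : i = j
  · rw [hij]
  rcases hT.meet i j hij q ⟨hi, hj⟩ with ⟨a, -, ha, -⟩ | ⟨a, b, he, hq⟩
  · obtain rfl : q = p := ha.symm.trans (hpq.2.2 i a ha)
    rw [sub_self, sub_self]
  · have hne : ∀ k c, (T k).vertex c ≠ (T k).vertex (c + 1) := fun k c h => by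
      have := (T k).vertex_injective h
      omega
    have hp := hpq.2.1 i a hq
    rw [sub_eq_ite_of_mem_pair (hf i a) (hne i a) (hT.nearbyVertex_mem hq) (hT.nearbyVertex_mem hp)]
    rw [he] at hq hp
    rw [sub_eq_ite_of_mem_pair (hf j b) (hne j b) (hT.nearbyVertex_mem hq) (hT.nearbyVertex_mem hp),
      he]

/-- The first cohomology of the cell complex of a tiling vanishes: a function on the edges whose sum
over the boundary of every tile is zero is the coboundary of a function on the vertices. -/
theorem IsEdgeToEdgeTiling.exists_coboundary [Finite ι] (hT : IsEdgeToEdgeTiling T)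
    (C : Set UnitSphere → ZMod 2) (hC : ∀ i, ∑ a, C ((T i).edge a) = 0) :
    ∃ σ : UnitSphere → ZMod 2,
      ∀ i a, C ((T i).edge a) = σ ((T i).vertex (a + 1)) - σ ((T i).vertex a) := by
  choose f hf using fun i => (T i).exists_primitive (fun a => C ((T i).edge a)) (hC i)
  choose t ht using hT.exists_mem_region
  set κ := nearbyVertex T with hκ
  have hsub : ∀ {p q}, IsNear T p q → ∀ {i j}, q ∈ (T i).region → q ∈ (T j).region →
      f i (κ q) - f i (κ p) = f j (κ q) - f j (κ p) := fun hpq => hT.primitive_sub_eq hf hpq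
  have hg : IsLocalDifference fun p q => f (t q) (κ q) - f (t q) (κ p) := by
    intro p
    filter_upwards [eventually_eventually_nhds.2 (eventually_isNear T p)] with x hx
    filter_upwards [eventually_isNear T x] with y hxy
    have h1 := hxy.1 _ (ht y)
    rw [hsub hx.self_of_nhds (ht x) h1]
    abel
  obtain ⟨σ, hσ⟩ := hg.exists_isPotentialOn_unitSphere
  refine ⟨σ, fun i a => ?_⟩
  -- On a tile the potential differs from the primitive by a locally constant function.
  have hcont : ContinuousOn (fun q => σ q - f i (κ q)) (T i).region := by
    intro p hp
    refine (continuousWithinAt_const (b := σ p - f i (κ p))).congr_of_eventuallyEq ?_ rfl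
    filter_upwards [self_mem_nhdsWithin, mem_nhdsWithin_of_mem_nhds (hσ p (mem_univ p)),
      mem_nhdsWithin_of_mem_nhds (eventually_isNear T p)] with q hq h1 h2
    have h1 : σ q = σ p + (f (t q) (κ q) - f (t q) (κ p)) := h1
    rw [h1, hsub h2 (ht q) hq]
    abel
  have h := (T i).isPreconnected_region.constant hcont ((T i).vertex_mem_region (a + 1))
    ((T i).vertex_mem_region a)
  simp only [hκ, nearbyVertex_vertex, hf i a] at h
  linear_combination -h

end Tiling

/-! ### Counting vertices, edges and tiles -/

section Counting

variable {ι : Type*} [Fintype ι] (T : ι → SphericalPentagon)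

open Classical in
/-- The vertices of the tiling. -/
noncomputable def vertexFinset : Finset UnitSphere :=
  Finset.univ.image fun x : ι × Fin 5 => (T x.1).vertex x.2

open Classical in
/-- The edges of the tiling, as subsets of the sphere. -/
noncomputable def edgeFinset : Finset (Set UnitSphere) :=
  Finset.univ.image fun x : ι × Fin 5 => (T x.1).edge x.2

variable {T}

theorem vertex_mem_vertexFinset (i : ι) (a : Fin 5) : (T i).vertex a ∈ vertexFinset T := by
  classical
  exact Finset.mem_image_of_mem (fun x : ι × Fin 5 => (T x.1).vertex x.2) (Finset.mem_univ (i, a))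

theorem edge_mem_edgeFinset (i : ι) (a : Fin 5) : (T i).edge a ∈ edgeFinset T := by
  classical
  exact Finset.mem_image_of_mem (fun x : ι × Fin 5 => (T x.1).edge x.2) (Finset.mem_univ (i, a))

theorem exists_edge_eq_of_mem_edgeFinset {e : Set UnitSphere} (he : e ∈ edgeFinset T) :
    ∃ x : ι × Fin 5, (T x.1).edge x.2 = e := by
  classical
  simpa [edgeFinset] using he

/-- One half of Euler's formula, `V - E + F ≥ 1`. The cocycles modulo `2` form a space of dimension
at least `E - F`; they are coboundaries, which form a space of dimension at most `V - 1`. -/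
theorem IsEdgeToEdgeTiling.card_edgeFinset_lt (hT : IsEdgeToEdgeTiling T) :
    (edgeFinset T).card < Fintype.card ι + (vertexFinset T).card := by
  classical
  have : Fact (Nat.Prime 2) := ⟨Nat.prime_two⟩
  choose r hr using fun e : edgeFinset T => exists_edge_eq_of_mem_edgeFinset e.2
  let edge : ι → Fin 5 → edgeFinset T := fun i a => ⟨(T i).edge a, edge_mem_edgeFinset i a⟩
  let vert : ι → Fin 5 → vertexFinset T := fun i a => ⟨(T i).vertex a, vertex_mem_vertexFinset i a⟩
  let D : (edgeFinset T → ZMod 2) →ₗ[ZMod 2] (ι → ZMod 2) :=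
    LinearMap.pi fun i => ∑ a, LinearMap.proj (edge i a)
  let δ : (vertexFinset T → ZMod 2) →ₗ[ZMod 2] (edgeFinset T → ZMod 2) :=
    LinearMap.pi fun e =>
      (LinearMap.proj (vert (r e).1 ((r e).2 + 1)) : (vertexFinset T → ZMod 2) →ₗ[ZMod 2] ZMod 2) -
        LinearMap.proj (vert (r e).1 (r e).2)
  have hle : LinearMap.ker D ≤ LinearMap.range δ := by
    intro C hC
    have hC : ∀ i, ∑ a, C (edge i a) = 0 := fun i => by
      have := congrFun (LinearMap.mem_ker.1 hC) i
      simpa [D] using this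
    obtain ⟨σ, hσ⟩ := hT.exists_coboundary
      (fun e => if h : e ∈ edgeFinset T then C ⟨e, h⟩ else 0) fun i => by
        simpa [edge_mem_edgeFinset] using hC i
    refine ⟨fun x => σ x, ?_⟩
    ext e
    have h := hσ (r e).1 (r e).2
    rw [dif_pos (edge_mem_edgeFinset _ _)] at h
    have he : (⟨(T (r e).1).edge (r e).2, edge_mem_edgeFinset _ _⟩ : edgeFinset T) = e :=
      Subtype.ext (hr e)
    rw [he] at h
    exact h.symm
  have hker : 0 < Module.finrank (ZMod 2) (LinearMap.ker δ) := by
    -- The constant function `1` is a nonzero element of the kernel.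
    obtain ⟨i, -⟩ := hT.exists_mem_region (Classical.choice
      (NormedSpace.sphere_nonempty.2 zero_le_one).to_subtype)
    have h1 : (fun _ => 1 : vertexFinset T → ZMod 2) ∈ LinearMap.ker δ := by
      rw [LinearMap.mem_ker]
      ext e
      simp [δ]
    refine Module.finrank_pos_iff_exists_ne_zero.2 ⟨⟨_, h1⟩, fun h => ?_⟩
    exact one_ne_zero (congrFun (congrArg Subtype.val h) (vert i 0))
  have h1 := D.finrank_range_add_finrank_ker
  have h2 := δ.finrank_range_add_finrank_ker
  have h3 := Submodule.finrank_mono hle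
  have h4 := (LinearMap.range D).finrank_le
  simp only [Module.finrank_fintype_fun_eq_card, Fintype.card_coe] at h1 h2 h4
  omega

/-- Each edge belongs to at most two tiles. -/
theorem IsEdgeToEdgeTiling.five_mul_card_le (hT : IsEdgeToEdgeTiling T) :
    5 * Fintype.card ι ≤ 2 * (edgeFinset T).card := by
  classical
  have h := Finset.card_le_mul_card_image (f := fun x : ι × Fin 5 => (T x.1).edge x.2)
    (Finset.univ : Finset (ι × Fin 5)) 2 fun e he => by
      obtain ⟨⟨i, a⟩, -, rfl⟩ := Finset.mem_image.1 he
      obtain ⟨j, ⟨-, b, hb⟩, hj⟩ := hT.edge_shared i a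
      refine (Finset.card_le_card (t := {(i, a), (j, b)}) ?_).trans Finset.card_le_two
      rintro ⟨k, c⟩ hk
      have hk : (T k).edge c = (T i).edge a := (Finset.mem_filter.1 hk).2
      rw [Finset.mem_insert, Finset.mem_singleton]
      by_cases hki : k = i
      · subst hki
        rw [SphericalPentagon.edge_injective hk]
        exact Or.inl rfl
      · obtain rfl := hj k ⟨hki, c, hk⟩
        rw [SphericalPentagon.edge_injective (hk.trans hb.symm)]
        exact Or.inr rfl
  rw [Finset.card_univ, Fintype.card_prod, Fintype.card_fin] at h
  rw [edgeFinset]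
  linarith

/-- At a vertex there are at least as many corners of tiles as edges: each corner has two edges, and
each edge belongs to at least two corners. -/
theorem IsEdgeToEdgeTiling.vertexDegree_le_card (hT : IsEdgeToEdgeTiling T) [DecidableEq UnitSphere]
    (x : UnitSphere) :
    vertexDegree T x ≤
      (Finset.univ.filter fun y : ι × Fin 5 => (T y.1).vertex y.2 = x).card := by
  classical
  -- `K ∪ K'` indexes the sides of tiles with the end point `x`; an edge counts once for each tile.
  set K := Finset.univ.filter fun y : ι × Fin 5 => (T y.1).vertex y.2 = x with hK
  set K' := Finset.univ.filter fun y : ι × Fin 5 => (T y.1).vertex (y.2 + 1) = x with hK'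
  have hKK' : K'.card ≤ K.card := by
    refine Finset.card_le_card_of_injOn (fun y => (y.1, y.2 + 1)) ?_ ?_
    · intro y hy
      simpa [hK, hK'] using hy
    · rintro ⟨i, a⟩ - ⟨j, b⟩ - h
      simpa using h
  have hdeg : vertexDegree T x = ((K ∪ K').image fun y => (T y.1).edge y.2).card := by
    rw [vertexDegree, ← Set.ncard_coe_finset]
    congr 1
    ext e
    simp only [mem_ofPred_eq, Finset.coe_image, Set.mem_image, Finset.mem_coe, Finset.mem_union, hK,
      hK', Finset.mem_filter, Finset.mem_univ, true_and, Prod.exists]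
    exact exists_congr fun i => exists_congr fun a => and_comm
  have h := Finset.mul_card_image_le_card (f := fun y : ι × Fin 5 => (T y.1).edge y.2) (K ∪ K') 2
    fun e he => by
      obtain ⟨⟨i, a⟩, hy, rfl⟩ := Finset.mem_image.1 he
      obtain ⟨j, ⟨hji, b, hb⟩, -⟩ := hT.edge_shared i a
      have hb : (T j).edge b = (T i).edge a := hb
      have hx : x ∈ ({(T i).vertex a, (T i).vertex (a + 1)} : Set UnitSphere) := by
        simp only [hK, hK', Finset.mem_union, Finset.mem_filter, Finset.mem_univ, true_and] at hy
        rcases hy with h | h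
        exacts [Or.inl h.symm, Or.inr h.symm]
      rw [← SphericalPentagon.pair_vertex_eq_of_edge_eq hb] at hx
      have hy' : (j, b) ∈ K ∪ K' := by
        simp only [hK, hK', Finset.mem_union, Finset.mem_filter, Finset.mem_univ, true_and]
        rcases hx with h | h
        exacts [Or.inl h.symm, Or.inr h.symm]
      rw [← Finset.card_pair (a := (i, a)) (b := (j, b)) fun h => hji (congrArg Prod.fst h).symm]
      refine Finset.card_le_card fun z hz => ?_
      rw [Finset.mem_insert, Finset.mem_singleton] at hz
      rcases hz with rfl | rfl
      exacts [Finset.mem_filter.2 ⟨hy, rfl⟩, Finset.mem_filter.2 ⟨hy', hb⟩]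
  rw [← hdeg] at h
  have := Finset.card_union_le K K'
  omega

/-- Each vertex distributes a total weight of at least `1` to the corners around it. -/
theorem IsEdgeToEdgeTiling.card_vertexFinset_le_sum (hT : IsEdgeToEdgeTiling T)
    (hdeg : ∀ i a, 0 < vertexDegree T ((T i).vertex a)) :
    ((vertexFinset T).card : ℚ) ≤ ∑ i, ∑ a, (vertexDegree T ((T i).vertex a) : ℚ)⁻¹ := by
  classical
  rw [← Fintype.sum_prod_type' (f := fun i a => (vertexDegree T ((T i).vertex a) : ℚ)⁻¹),
    ← Finset.sum_fiberwise_of_maps_to (t := vertexFinset T)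
      (g := fun y : ι × Fin 5 => (T y.1).vertex y.2) fun y _ => vertex_mem_vertexFinset y.1 y.2,
    Finset.card_eq_sum_ones, Nat.cast_sum]
  refine Finset.sum_le_sum fun x hx => ?_
  have hpos : 0 < vertexDegree T x := by
    obtain ⟨y, -, rfl⟩ := Finset.mem_image.1 hx
    exact hdeg _ _
  rw [Finset.sum_congr rfl (g := fun _ => (vertexDegree T x : ℚ)⁻¹) fun y hy => by
    rw [(Finset.mem_filter.1 hy).2], Finset.sum_const, nsmul_eq_mul, Nat.cast_one,
    ← div_eq_mul_inv, one_le_div (by exact_mod_cast hpos)]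
  exact_mod_cast hT.vertexDegree_le_card x

/-- The total weight of the corners of a tile is at most `3 / 2` unless four of the degrees are `3`
and the fifth is `3`, `4` or `5`. The extreme cases are the degrees `3, 3, 3, 4, 4` and
`3, 3, 3, 3, 6`. -/
theorem sum_inv_le_of_forall_not {d : Fin 5 → ℕ} (hd : ∀ a, 3 ≤ d a)
    (h : ∀ a, ¬((∀ b, b ≠ a → d b = 3) ∧ (d a = 3 ∨ d a = 4 ∨ d a = 5))) :
    ∑ a, (d a : ℚ)⁻¹ ≤ 3 / 2 := by
  have hinv : ∀ (a : Fin 5) (n : ℕ), 0 < n → n ≤ d a → (d a : ℚ)⁻¹ ≤ (n : ℚ)⁻¹ := by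
    intro a n hn h
    exact inv_anti₀ (by exact_mod_cast hn) (by exact_mod_cast h)
  have h3 : ∀ a, (d a : ℚ)⁻¹ ≤ 1 / 3 := fun a => by
    have := hinv a 3 (by norm_num) (hd a)
    norm_num at this ⊢
    exact this
  obtain ⟨a, ha⟩ : ∃ a, 3 < d a := by
    by_contra! hall
    have hall : ∀ b, d b = 3 := fun b => le_antisymm (hall b) (hd b)
    exact h 0 ⟨fun b _ => hall b, Or.inl (hall 0)⟩
  by_cases hb : ∃ b, b ≠ a ∧ 3 < d b
  · obtain ⟨b, hba, hb⟩ := hb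
    have ha4 := hinv a 4 (by norm_num) ha
    have hb4 := hinv b 4 (by norm_num) hb
    calc ∑ c, (d c : ℚ)⁻¹
        ≤ ∑ c, (1 / 3 - (if c = a then 1 / 12 else 0) - (if c = b then 1 / 12 else 0) : ℚ) := by
          refine Finset.sum_le_sum fun c _ => ?_
          by_cases hca : c = a
          · subst hca
            rw [if_pos rfl, if_neg hba.symm]
            norm_num at ha4 ⊢
            exact ha4
          · by_cases hcb : c = b
            · subst hcb
              rw [if_neg hca, if_pos rfl]
              norm_num at hb4 ⊢
              exact hb4
            · rw [if_neg hca, if_neg hcb, sub_zero, sub_zero]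
              exact h3 c
      _ = 3 / 2 := by
          simp only [Finset.sum_sub_distrib, Finset.sum_ite_eq', Finset.mem_univ, if_true,
            Finset.sum_const, Finset.card_univ, Fintype.card_fin, nsmul_eq_mul]
          norm_num
  · push Not at hb
    have hb : ∀ b, b ≠ a → d b = 3 := fun b hba => le_antisymm (hb b hba) (hd b)
    have ha6 : 6 ≤ d a := by
      by_contra hlt
      exact h a ⟨hb, by omega⟩
    have ha6 := hinv a 6 (by norm_num) ha6
    calc ∑ c, (d c : ℚ)⁻¹ ≤ ∑ c, (1 / 3 - (if c = a then 1 / 6 else 0) : ℚ) := by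
          refine Finset.sum_le_sum fun c _ => ?_
          by_cases hca : c = a
          · subst hca
            rw [if_pos rfl]
            norm_num at ha6 ⊢
            exact ha6
          · rw [if_neg hca, sub_zero]
            exact h3 c
      _ = 3 / 2 := by
          simp only [Finset.sum_sub_distrib, Finset.sum_ite_eq', Finset.mem_univ, if_true,
            Finset.sum_const, Finset.card_univ, Fintype.card_fin, nsmul_eq_mul]
          norm_num

end Counting

theorem mainTheorem5 {ι : Type*} [Finite ι] (T : ι → SphericalPentagon)
    (hT : IsEdgeToEdgeTiling T)
    (hdeg : ∀ (i : ι) (a : Fin 5), 3 ≤ vertexDegree T ((T i).vertex a)) :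
    ∃ (i : ι) (a : Fin 5),
      (∀ b : Fin 5, b ≠ a → vertexDegree T ((T i).vertex b) = 3) ∧
      (vertexDegree T ((T i).vertex a) = 3 ∨ vertexDegree T ((T i).vertex a) = 4 ∨
        vertexDegree T ((T i).vertex a) = 5) := by
  by_contra hcon
  rw [not_exists] at hcon
  cases nonempty_fintype ι
  have hV := hT.card_vertexFinset_le_sum fun i a => lt_of_lt_of_le three_pos (hdeg i a)
  have hsum : ∑ i, ∑ a, (vertexDegree T ((T i).vertex a) : ℚ)⁻¹ ≤ ∑ _i : ι, (3 / 2 : ℚ) :=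
    Finset.sum_le_sum fun i _ => sum_inv_le_of_forall_not (hdeg i) (not_exists.1 (hcon i))
  rw [Finset.sum_const, Finset.card_univ, nsmul_eq_mul] at hsum
  have hE : (5 * Fintype.card ι : ℚ) ≤ 2 * (edgeFinset T).card := by
    exact_mod_cast hT.five_mul_card_le
  have hχ : ((edgeFinset T).card : ℚ) < Fintype.card ι + (vertexFinset T).card := by
    exact_mod_cast hT.card_edgeFinset_lt
  linarith
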